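/- **Notation.** Write a permutation $\pi\in S_m$ as $[a_1,\dots,a_m]$, $a_i=\pi(i)$. For $2\le i\le m$ the push-to-the-top operation is $t_i[a_1,\dots,a_m]=[a_i,a_1,\dots,a_{i-1},a_{i+1},\dots,a_m]$. Kendall's $\tau$-distance $d_K(\pi_1,\pi_2)$ is the least number of exchanges of two adjacent entries that turn $\pi_1$ into $\pi_2$. A $\mathcal K$-snake of length $M$ in $S_m$ is a sequence $c_0,\dots,c_{M-1}$ of distinct permutations in $S_m$ such that each $c_{j+1}$ (indices modulo $M$) is $t_i(c_j)$ for some $2\le i\le m$, and $d_K(c_i,c_j)\ge2$ for $i\ne j$. For $n\ge2$ let $[x,y]$ be the class of even permutations of $\{1,\dots,2n+1\}$ whose last two entries are $x,y$ in this order. The necklace $[\alpha]-[x,y]$ is the set of the $2n-1$ permutations in $[x,y]$ whose first $2n-1$ entries form a cyclic shift of $\alpha$. Write $\langle x,y,z\rangle=\{[x,y],[y,z],[z,x]\}$. The sets $T_{2n+1}$ of such triples are defined recursively: $$T_5=\{\langle1,2,5\rangle,\langle1,2,4\rangle,\langle1,2,3\rangle,\langle1,4,5\rangle,\langle2,5,4\rangle,\langle1,3,4\rangle,\langle2,4,3\rangle,\langle1,5,3\rangle,\langle2,3,5\rangle\},$$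 and for $n\ge3$, $T_{2n+1}$ consists of the triples of $T_{2n-1}$, of $\langle x,x+1,2n\rangle$ and $\langle x,x+1,2n+1\rangle$ for $2\le x\le2n-2$, and of $\langle1,2,2n\rangle$, $\langle1,2n,2n-1\rangle$, $\langle1,2n+1,2n-1\rangle$, $\langle1,2n,2n+1\rangle$, $\langle2,2n+1,2n\rangle$. For a necklace $[\alpha]-[1,2]$, the chain $c[\alpha]$ is the union of the smallest family of necklaces that contains $[\alpha]-[1,2]$ and that, for each $\langle x,y,z\rangle\in T_{2n+1}$, with a necklace $[\beta,z]-[x,y]$ also contains $[\beta,y]-[z,x]$ and $[\beta,x]-[y,z]$. For $n\ge3$ let $\mathcal G_{2n+1}$ be the multigraph whose vertices are the chains, with the following edges: for each $6\le x\le2n+1$ and each $\alpha$ such that $[\alpha,x,2,1]$ is an even permutation of $\{1,\dots,2n+1\}$, there is an edge with sign $M[x]$ and label $[\alpha,x]-[2,1]$ between the chain containing $[\alpha,2,1,x]$ and the chain containing $[\alpha,1,x,2]$ if these chains are distinct. An isomorphism of such multigraphs is a pair of bijections, of the vertices and of the labels, that preserves edges together with their labels and signs. For $n\ge4$ a component $A$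 of $\mathcal G_{2n+1}$ is given by the set of vertices and the set of labels of a subgraph isomorphic to $\mathcal G_{2n-1}$. For $n=3$ a component is a single chain together with one label, where the labels are assigned to the chains by an arbitrary fixed bijection from the chains onto the necklaces $[\beta]-[2,1]$. The component graph $\hat{\mathcal G}_{2n+1}$ ($n\ge3$) is the multigraph whose vertices are the components. For $x\in\{2n,2n+1\}$ it has an edge with sign $M[x]$ and label $[\alpha,x]-[2,1]$ between $A$ and $B$ whenever the chain containing $[\alpha,2,1,x]$ belongs to $A$ and the chain containing $[\alpha,1,x,2]$ belongs to $B$. A components spanning tree is a spanning tree of $\hat{\mathcal G}_{2n+1}$ such that no two different edges of the tree have labels that belong to the same component. **Theorem.** Assume that for every $n\ge3$, every component $A$ in $\hat{\mathcal G}_{2n+1}$ and every label $\eta$ of $A$ there is a components spanning tree of $\hat{\mathcal G}_{2n+1}$ with no edge labelled $\eta$. Then for every $n\ge2$ there is a $\mathcal K$-snake in $S_{2n+1}$ of length $\frac{(2n+1)!}{2}-(2n-1)$ in which every transition is $t_{2n-1}$ or $t_{2n+1}$. -/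

import Mathlib

namespace RankModulation

/-! ### Permutations, push-to-the-top, Kendall's distance, snakes

A permutation `[a_1, …, a_m]` of `{1, …, m}` is an element `π` of `Equiv.Perm (Fin m)`, with
positions and symbols shifted by one: `a_i = π (i - 1) + 1`. -/

/-- The symbol `a_i` at position `i` of `π = [a_1, …, a_m]`, for `1 ≤ i ≤ m` (and `0` past the
end). -/
def symbol {m : ℕ} (π : Equiv.Perm (Fin m)) (i : ℕ) : ℕ :=
  if h : i - 1 < m then (π ⟨i - 1, h⟩ : ℕ) + 1 else 0

/-- The push-to-the-top operation `t_i`, for `1 ≤ i ≤ m`: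
`[a_1, …, a_{i-1}, a_i, a_{i+1}, …, a_m] ↦ [a_i, a_1, …, a_{i-1}, a_{i+1}, …, a_m]`. -/
def pushTop {m : ℕ} (i : ℕ) (π : Equiv.Perm (Fin m)) : Equiv.Perm (Fin m) :=
  if h : i - 1 < m then π * (Fin.cycleRange ⟨i - 1, h⟩)⁻¹ else π

/-- The exchange of two adjacent positions: `π * s` is `π` with two adjacent entries exchanged. -/
def IsAdjacentTransposition {m : ℕ} (s : Equiv.Perm (Fin m)) : Prop :=
  ∃ i j : Fin m, (j : ℕ) = (i : ℕ) + 1 ∧ s = Equiv.swap i j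

/-- Kendall's `τ`-distance: the least number of adjacent transpositions that lead from `π₁` to
`π₂`. -/
noncomputable def kendallDist {m : ℕ} (π₁ π₂ : Equiv.Perm (Fin m)) : ℕ :=
  sInf {k : ℕ | ∃ l : List (Equiv.Perm (Fin m)),
    l.length = k ∧ (∀ s ∈ l, IsAdjacentTransposition s) ∧ π₂ = π₁ * l.prod}

/-- A cyclic Gray code `c_0, …, c_{M-1}` of size `M` over `S` with transitions from `T`. -/
structure IsGrayCode {S : Type*} (T : Set (S → S)) {M : ℕ} (c : Fin M → S) : Prop where
  distinct : Function.Injective c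
  step : ∀ j : Fin M, ∃ t ∈ T, c (finRotate M j) = t (c j)

/-- A snake-in-the-box code in `S_m` of size `M` under Kendall's `τ`-metric: a cyclic Gray code
with push-to-the-top transitions, any two codewords of which are at distance at least `2`. -/
structure IsKSnake {m M : ℕ} (c : Fin M → Equiv.Perm (Fin m)) : Prop where
  gray : IsGrayCode {t | ∃ i : ℕ, 2 ≤ i ∧ i ≤ m ∧ t = pushTop i} c
  dist : ∀ i j : Fin M, i ≠ j → 2 ≤ kendallDist (c i) (c j)

/-! ### Necklaces and chains in `S_{2n+1}` -/

/-- Permutations of `{1, …, 2n+1}`. -/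
abbrev P (n : ℕ) : Type := Equiv.Perm (Fin (2 * n + 1))

/-- The class `[x, y]`: the even permutations whose last ordered pair of symbols is `(x, y)`. -/
def permClass (n x y : ℕ) : Set (P n) :=
  {π | Equiv.Perm.sign π = 1 ∧ symbol π (2 * n) = x ∧ symbol π (2 * n + 1) = y}

/-- The necklace of `π = [a_1, …, a_{2n-1}, x, y]`, i.e. `[a_1, …, a_{2n-1}]-[x, y]`: all
permutations obtained from `π` by cyclic shifts of the first `2n-1` entries. -/
def necklace {n : ℕ} (π : P n) : Set (P n) :=
  {ρ | ∃ k : ℕ, ρ = (pushTop (2 * n - 1))^[k] π}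

/-- `[α, z, x, y] ↦ [α, y, z, x]`, where `α` has length `2n-2`. -/
def shiftLastThree {n : ℕ} (π : P n) : P n :=
  π * (Equiv.swap ⟨2 * n - 2, by omega⟩ ⟨2 * n, by omega⟩ *
    Equiv.swap ⟨2 * n, by omega⟩ ⟨2 * n - 1, by omega⟩)

/-- The hyperedges `⟨x, y, z⟩ = {[x, y], [y, z], [z, x]}` of the nearly spanning tree `T_{2n+1}`
(`n ≥ 2`), each listed by one of its three cyclic rotations. In the recursive clause the tree is
`T_{2N+1}` with `N = n + 3`. -/
def treeTriples : ℕ → Set (ℕ × ℕ × ℕ)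
  | 0 => ∅
  | 1 => ∅
  | 2 => {(1, 2, 5), (1, 2, 4), (1, 2, 3), (1, 4, 5), (2, 5, 4), (1, 3, 4), (2, 4, 3),
      (1, 5, 3), (2, 3, 5)}
  | n + 3 =>
    let N := n + 3
    treeTriples (n + 2) ∪
      {e | ∃ x : ℕ, 2 ≤ x ∧ x ≤ 2 * N - 2 ∧
        (e = (x, x + 1, 2 * N) ∨ e = (x, x + 1, 2 * N + 1))} ∪
      {(1, 2, 2 * N), (1, 2 * N, 2 * N - 1), (1, 2 * N + 1, 2 * N - 1),
        (1, 2 * N, 2 * N + 1), (2, 2 * N + 1, 2 * N)}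

/-- `{[x, y], [y, z], [z, x]}` is a hyperedge of `T_{2n+1}`. -/
def IsTreeHyperedge (n x y z : ℕ) : Prop :=
  (x, y, z) ∈ treeTriples n ∨ (y, z, x) ∈ treeTriples n ∨ (z, x, y) ∈ treeTriples n

/-- The codewords of the chain started at `π₀` (in the class `[1, 2]`): it contains `π₀`; with a
permutation it contains its whole necklace; and, for each hyperedge `{[x, y], [y, z], [z, x]}` of
`T_{2n+1}`, with the necklace `[α, z]-[x, y]` it contains the necklaces `[α, y]-[z, x]` and
`[α, x]-[y, z]` joined to it along this hyperedge (one and two applications of `join`). -/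
inductive InChain (n : ℕ) (π₀ : P n) : P n → Prop
  | base : InChain n π₀ π₀
  | rotate {π : P n} : InChain n π₀ π → InChain n π₀ (pushTop (2 * n - 1) π)
  | join {π : P n} : InChain n π₀ π →
      IsTreeHyperedge n (symbol π (2 * n)) (symbol π (2 * n + 1)) (symbol π (2 * n - 1)) →
      InChain n π₀ (shiftLastThree π)

/-- The chains `c[α]`, each given by its set of codewords. -/
def chains (n : ℕ) : Set (Set (P n)) :=
  {c | ∃ π₀ ∈ permClass n 1 2, c = {π | InChain n π₀ π}}

/-- The `[2, 1]`-necklaces. -/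
def necklaces21 (n : ℕ) : Set (Set (P n)) :=
  {η | ∃ π ∈ permClass n 2 1, η = necklace π}

/-! ### Multi-graphs with labels and signs on the edges -/

/-- A multi-graph whose edges carry a label and a sign; the sign `M[x]` is recorded as `x`. An
edge is the triple of its pair of endpoints, its label and its sign. -/
structure SignedGraph (V L : Type*) where
  verts : Set V
  edges : Set (Sym2 V × L × ℕ)
  incident : ∀ e ∈ edges, ∀ v ∈ e.1, v ∈ verts

namespace SignedGraph

variable {V L V' L' : Type*}

/-- The labels on the edges. -/
def labels (G : SignedGraph V L) : Set L :=
  {η | ∃ e ∈ G.edges, e.2.1 = η}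

def IsSubgraph (H G : SignedGraph V L) : Prop :=
  H.verts ⊆ G.verts ∧ H.edges ⊆ G.edges

/-- Isomorphism: bijections of the vertices and of the labels that respect edges, labels and
signs. -/
def IsIsomorphic (G : SignedGraph V L) (G' : SignedGraph V' L') : Prop :=
  ∃ (f : V → V') (g : L → L'),
    Set.BijOn f G.verts G'.verts ∧ Set.BijOn g G.labels G'.labels ∧
    ∀ u ∈ G.verts, ∀ v ∈ G.verts, ∀ η ∈ G.labels, ∀ x : ℕ,
      (s(u, v), η, x) ∈ G.edges ↔ (s(f u, f v), g η, x) ∈ G'.edges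

/-- The simple graph on the vertices of `G` that underlies a set `F` of edges. -/
def underlying (G : SignedGraph V L) (F : Set (Sym2 V × L × ℕ)) : SimpleGraph G.verts where
  Adj u v := u ≠ v ∧ ∃ (η : L) (x : ℕ), (s((u : V), (v : V)), η, x) ∈ F
  symm := ⟨fun u v h => ⟨h.1.symm, by
    obtain ⟨η, x, hx⟩ := h.2
    exact ⟨η, x, by rwa [Sym2.eq_swap]⟩⟩⟩
  loopless := ⟨fun u h => h.1 rfl⟩

/-- The edge set `F` is a spanning tree of the multi-graph `G`: it has no loops and no parallel
edges, and the underlying simple graph on all vertices of `G` is a tree. -/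
def IsSpanningTree (G : SignedGraph V L) (F : Set (Sym2 V × L × ℕ)) : Prop :=
  F ⊆ G.edges ∧ (∀ e ∈ F, ¬ e.1.IsDiag) ∧ (∀ e ∈ F, ∀ e' ∈ F, e.1 = e'.1 → e = e') ∧
    (G.underlying F).IsTree

end SignedGraph

/-! ### The graph of chains, its components, and the component graph -/

/-- `c₁` and `c₂` are chains that contain `[α, 2, 1, x]` and `[α, 1, x, 2]`, respectively, and
`η` is the necklace `[α, x]-[2, 1]`, for some `α`; here `π = [α, x, 2, 1]`. -/
def Connects (n x : ℕ) (c₁ c₂ η : Set (P n)) : Prop :=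
  c₁ ∈ chains n ∧ c₂ ∈ chains n ∧
    ∃ π ∈ permClass n 2 1, symbol π (2 * n - 1) = x ∧
      shiftLastThree (shiftLastThree π) ∈ c₁ ∧ shiftLastThree π ∈ c₂ ∧ η = necklace π

/-- The multi-graph `𝒢_{2n+1}` of chains: edges signed `M[x]`, `6 ≤ x ≤ 2n+1`, labelled by
`[2, 1]`-necklaces. -/
def chainGraph (n : ℕ) : SignedGraph (Set (P n)) (Set (P n)) where
  verts := chains n
  edges := {e | ∃ c₁ c₂ η x, e = (s(c₁, c₂), η, x) ∧ 6 ≤ x ∧ x ≤ 2 * n + 1 ∧ c₁ ≠ c₂ ∧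
    Connects n x c₁ c₂ η}
  incident := by
    rintro _ ⟨c₁, c₂, η, x, rfl, -, -, -, h₁, h₂, -⟩ v hv
    rcases Sym2.mem_iff.1 hv with rfl | rfl
    · exact h₁
    · exact h₂

/-- A component is recorded as `A = (𝒱_A, ℒ_A)`, its set of chains and its set of labels. -/
abbrev Comp (n : ℕ) : Type := Set (Set (P n)) × Set (Set (P n))

/-- The components, i.e. the vertices of the component graph of `𝒢_{2n+1}`. For `n ≥ 4` they are
the subgraphs of `𝒢_{2n+1}` isomorphic to `𝒢_{2n-1}`. For `n = 3` each consists of one chain and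
one `[2, 1]`-necklace, distinct chains having distinct necklaces: `b` is the assignment of
necklaces to chains. -/
def IsComponent (b : Set (P 3) → Set (P 3)) : (n : ℕ) → Comp n → Prop
  | 0, _ => False
  | 1, _ => False
  | 2, _ => False
  | 3, A => ∃ c ∈ chains 3, A = ({c}, {b c})
  | k + 4, A => ∃ H : SignedGraph (Set (P (k + 4))) (Set (P (k + 4))),
      H.IsSubgraph (chainGraph (k + 4)) ∧ H.IsIsomorphic (chainGraph (k + 3)) ∧
      A = (H.verts, H.labels)

/-- The component graph: edges signed `M[x]`, `x ∈ {2n, 2n+1}`, labelled by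
`[2, 1]`-necklaces. -/
def componentGraph (b : Set (P 3) → Set (P 3)) (n : ℕ) : SignedGraph (Comp n) (Set (P n)) where
  verts := {A | IsComponent b n A}
  edges := {e | ∃ A B η x, e = (s(A, B), η, x) ∧ IsComponent b n A ∧ IsComponent b n B ∧
    (x = 2 * n ∨ x = 2 * n + 1) ∧ ∃ c₁ ∈ A.1, ∃ c₂ ∈ B.1, Connects n x c₁ c₂ η}
  incident := by
    rintro _ ⟨A, B, η, x, rfl, hA, hB, -⟩ v hv
    rcases Sym2.mem_iff.1 hv with rfl | rfl
    · exact hA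
    · exact hB

/-- A components spanning tree: a spanning tree of the component graph such that different edges
of the tree have labels from different components. -/
def IsComponentsSpanningTree (b : Set (P 3) → Set (P 3)) (n : ℕ)
    (F : Set (Sym2 (Comp n) × Set (P n) × ℕ)) : Prop :=
  (componentGraph b n).IsSpanningTree F ∧
    ∀ e ∈ F, ∀ e' ∈ F, ∀ A, IsComponent b n A → e.2.1 ∈ A.2 → e'.2.1 ∈ A.2 → e = e'

end RankModulation

open RankModulation

/-!
# Snakes of length `(2n+1)!/2 - (2n-1)` in `S_{2n+1}`

The snake is constructed without the hypothesis on components spanning trees. A hypertree on the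
even permutations of `m ≥ 4` symbols other than the identity, whose hyperedges are cosets of
`3`-cycles on two fixed positions and a third one, is built by induction on `m`. Its last stage is a
hypertree on representatives of all necklaces but one, along which the necklaces are joined to a
cyclic list.
-/

namespace RankModulation

open Equiv Equiv.Perm

/-! ### Hypertrees -/

/-! Let `B` and `A` be the right factors of $t_{2n-1}$ and $t_{2n+1}$. The cosets of the powers of
`B` are the necklaces, and `d = A * B⁻¹` is a 3-cycle on the last three positions. Suppose `y`, `y *
d`, `y * d ^ 2` lie on three disjoint closed tours and each is left by `B`. Since `y * A = (y * d) *
B`, replacing these three steps by `A` merges the tours into one. Hence a hypertree of such triples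
on a set of necklaces yields a single tour through them (`IsCyclicChain.merge`,
`HTree.exists_cyclic_list`). Only even permutations occur, so distinct codewords are at distance at
least 2.

A hypertree of triples has an odd number of vertices, whereas the number of necklaces,
$n(2n+1)(2n-2)!$, is even; so at least one necklace must be left out, and exactly one is.

To find the hypertree, fix two positions `a`, `b`. The entries there determine a further symbol, the
`slot`, and the index of a permutation is the position of that symbol. Rotating the other positions
moves the index but not the slot, so the even permutations of a fixed index represent each necklace
once. Those of index `q` form, up to one omitted permutation, a copy of the even permutations of one
symbol fewer with pairs of leaves attached (`HTree.add_symbol`). In `hTree_even` the hypertrees of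
the different indices are glued along hyperedges through the omitted permutations, and this closes
the induction on the number of symbols. -/

/-- `HTree E V`: the hyperedges of a hypertree with vertex set `V` can be found among the triples
that satisfy `E`. -/
inductive HTree {V : Type*} (E : V → V → V → Prop) : Set V → Prop
  | single (v : V) : HTree E {v}
  | join {A B C : Set V} {x y z : V} : HTree E A → HTree E B → HTree E C →
      Disjoint A B → Disjoint A C → Disjoint B C → x ∈ A → y ∈ B → z ∈ C → E x y z →
      HTree E (A ∪ B ∪ C)

theorem HTree.map {V V' : Type*} {E : V → V → V → Prop} {E' : V' → V' → V' → Prop} {f : V → V'}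
    (hf : Function.Injective f) (hE : ∀ x y z, E x y z → E' (f x) (f y) (f z)) {A : Set V}
    (hA : HTree E A) : HTree E' (f '' A) := by
  induction hA with
  | single v => rw [Set.image_singleton]; exact .single _
  | join _ _ _ hAB hAC hBC hx hy hz hxyz ihA ihB ihC =>
    rw [Set.image_union, Set.image_union]
    exact .join ihA ihB ihC ((Set.disjoint_image_iff hf).2 hAB) ((Set.disjoint_image_iff hf).2 hAC)
      ((Set.disjoint_image_iff hf).2 hBC) (Set.mem_image_of_mem f hx) (Set.mem_image_of_mem f hy)
      (Set.mem_image_of_mem f hz) (hE _ _ _ hxyz)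

/-- Pairs of hypertrees `A i`, `B i` can be attached simultaneously to a hypertree `V₀`. -/
theorem HTree.star {V ι : Type*} {E : V → V → V → Prop} {V₀ : Set V} (h₀ : HTree E V₀)
    (s : Finset ι) (A B : ι → Set V) (hA : ∀ i ∈ s, HTree E (A i)) (hB : ∀ i ∈ s, HTree E (B i))
    (hAB : ∀ i ∈ s, Disjoint (A i) (B i)) (hd₀ : ∀ i ∈ s, Disjoint V₀ (A i ∪ B i))
    (hd : ∀ i ∈ s, ∀ j ∈ s, i ≠ j → Disjoint (A i ∪ B i) (A j ∪ B j))
    (hE : ∀ i ∈ s, ∃ x ∈ V₀, ∃ y ∈ A i, ∃ z ∈ B i, E x y z) :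
    HTree E (V₀ ∪ ⋃ i ∈ s, (A i ∪ B i)) := by
  classical
  induction s using Finset.induction_on with
  | empty => simpa using h₀
  | insert i s his ih =>
    have ih := ih (fun j hj => hA j (Finset.mem_insert_of_mem hj))
      (fun j hj => hB j (Finset.mem_insert_of_mem hj))
      (fun j hj => hAB j (Finset.mem_insert_of_mem hj))
      (fun j hj => hd₀ j (Finset.mem_insert_of_mem hj))
      (fun j hj k hk => hd j (Finset.mem_insert_of_mem hj) k (Finset.mem_insert_of_mem hk))
      (fun j hj => hE j (Finset.mem_insert_of_mem hj))
    have hi := Finset.mem_insert_self i s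
    have hdis : Disjoint (V₀ ∪ ⋃ j ∈ s, (A j ∪ B j)) (A i ∪ B i) := by
      refine Disjoint.union_left (hd₀ i hi) ?_
      simp only [Set.disjoint_iUnion_left]
      intro j hj
      exact hd j (Finset.mem_insert_of_mem hj) i hi (by rintro rfl; exact his hj)
    obtain ⟨x, hx, y, hy, z, hz, hxyz⟩ := hE i hi
    have h := HTree.join ih (hA i hi) (hB i hi) (hdis.mono_right Set.subset_union_left)
      (hdis.mono_right Set.subset_union_right) (hAB i hi) (Or.inl hx) hy hz hxyz
    convert h using 1
    rw [Finset.set_biUnion_insert]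
    ext w
    simp only [Set.mem_union]
    tauto

/-! ### The hypergraph on permutations -/

section

variable {S : Type*} [DecidableEq S]

/-- The `3`-cycle `p ↦ a ↦ b ↦ p`. -/
def rot3 (p a b : S) : Perm S := swap p a * swap a b

theorem rot3_p {p a b : S} (hpb : p ≠ b) (hpa : p ≠ a) : rot3 p a b p = a := by
  simp [rot3, swap_apply_of_ne_of_ne hpa hpb]

theorem rot3_a {p a b : S} (hab : a ≠ b) (hpb : p ≠ b) : rot3 p a b a = b := by
  simp [rot3, swap_apply_of_ne_of_ne hpb.symm hab.symm]

theorem rot3_b {p a b : S} : rot3 p a b b = p := by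
  simp [rot3]

theorem rot3_of_ne {p a b x : S} (hp : x ≠ p) (ha : x ≠ a) (hb : x ≠ b) : rot3 p a b x = x := by
  simp [rot3, swap_apply_of_ne_of_ne, *]

theorem rot3_inv_p {p a b : S} : (rot3 p a b)⁻¹ p = b := by
  rw [Perm.inv_eq_iff_eq, rot3_b]

theorem rot3_inv_a {p a b : S} (hpb : p ≠ b) (hpa : p ≠ a) :
    (rot3 p a b)⁻¹ a = p := by
  rw [Perm.inv_eq_iff_eq, rot3_p hpb hpa]

theorem rot3_inv_b {p a b : S} (hab : a ≠ b) (hpb : p ≠ b) : (rot3 p a b)⁻¹ b = a := by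
  rw [Perm.inv_eq_iff_eq, rot3_a hab hpb]

theorem rot3_inv_of_ne {p a b x : S} (hp : x ≠ p) (ha : x ≠ a) (hb : x ≠ b) :
    (rot3 p a b)⁻¹ x = x := by
  rw [Perm.inv_eq_iff_eq, rot3_of_ne hp ha hb]

theorem rot3_mul_self {p a b : S} (hab : a ≠ b) (hpb : p ≠ b) (hpa : p ≠ a) :
    rot3 p a b * rot3 p a b = (rot3 p a b)⁻¹ := by
  ext x
  rw [Perm.mul_apply]
  by_cases hp : x = p
  · subst hp; rw [rot3_p hpb hpa, rot3_a hab hpb, rot3_inv_p]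
  by_cases ha : x = a
  · subst ha; rw [rot3_a hab hpb, rot3_b, rot3_inv_a hpb hpa]
  by_cases hb : x = b
  · subst hb; rw [rot3_b, rot3_p hpb hpa, rot3_inv_b hab hpb]
  · rw [rot3_inv_of_ne hp ha hb, rot3_of_ne hp ha hb, rot3_of_ne hp ha hb]

theorem sign_rot3 [Fintype S] {p a b : S} (hab : a ≠ b) (hpa : p ≠ a) : sign (rot3 p a b) = 1 := by
  simp [rot3, sign_swap hab, sign_swap hpa]

theorem conj_rot3 (G : Perm S) (p a b : S) :
    G * rot3 p a b * G⁻¹ = rot3 (G p) (G a) (G b) := by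
  simp only [rot3, swap_apply_apply]
  group

/-- The hyperedges `{g, g c, g c²}`, with `c` a `3`-cycle on `a`, `b` and a third position. -/
def Tri (a b : S) (g₁ g₂ g₃ : Perm S) : Prop :=
  ∃ p, p ≠ a ∧ p ≠ b ∧ ((g₂ = g₁ * rot3 p a b ∧ g₃ = g₁ * (rot3 p a b)⁻¹) ∨
    (g₃ = g₁ * rot3 p a b ∧ g₂ = g₁ * (rot3 p a b)⁻¹))

theorem Tri.swap {a b : S} {g₁ g₂ g₃ : Perm S} (h : Tri a b g₁ g₂ g₃) : Tri a b g₁ g₃ g₂ := by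
  obtain ⟨p, ha, hb, h⟩ := h
  exact ⟨p, ha, hb, h.symm⟩

theorem Tri.rotate {a b : S} (hab : a ≠ b) {g₁ g₂ g₃ : Perm S} (h : Tri a b g₁ g₂ g₃) :
    Tri a b g₂ g₃ g₁ := by
  obtain ⟨p, ha, hb, ⟨rfl, rfl⟩ | ⟨rfl, rfl⟩⟩ := h
  · exact ⟨p, ha, hb, Or.inl ⟨by rw [mul_assoc, rot3_mul_self hab hb ha], by group⟩⟩
  · refine ⟨p, ha, hb, Or.inr ⟨by group, ?_⟩⟩
    rw [mul_assoc, ← mul_inv_rev, rot3_mul_self hab hb ha, inv_inv]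

end

/-! ### The index of a permutation and the insertion of a symbol -/

section

variable {S : Type*} [DecidableEq S]

/-- Given the entries `x`, `y` in the positions `a`, `b`, the entry that determines the index of a
permutation: `u` itself if it is not among `x`, `y`, and a neighbour under `φ` of the other entry
otherwise. -/
def slot (φ : Perm S) (u x y : S) : S :=
  if y = u then φ⁻¹ x else if x = u then φ y else u

theorem slot_right (φ : Perm S) (u x : S) : slot φ u x u = φ⁻¹ x := by simp [slot]

theorem slot_left {φ : Perm S} {u y : S} (h : y ≠ u) : slot φ u u y = φ y := by simp [slot, h]

theorem slot_of_ne {φ : Perm S} {u x y : S} (hx : x ≠ u) (hy : y ≠ u) : slot φ u x y = u := by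
  simp [slot, hx, hy]

/-- As the slot is never an entry at `a` or `b`, the index is a position other than these two. -/
theorem slot_ne {φ : Perm S} {u x y : S} (hxy : x ≠ y) (hφu : φ u = u)
    (hφ : ∀ x, x ≠ u → φ x ≠ x) : slot φ u x y ≠ x ∧ slot φ u x y ≠ y := by
  by_cases hy : y = u
  · subst hy
    rw [slot_right, Ne, Ne, Perm.inv_eq_iff_eq, Perm.inv_eq_iff_eq, hφu]
    exact ⟨(hφ x hxy).symm, hxy⟩
  by_cases hx : x = u
  · subst hx
    rw [slot_left hy]
    refine ⟨fun h => hy (φ.injective (h.trans hφu.symm)), hφ y hy⟩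
  · rw [slot_of_ne hx hy]
    exact ⟨Ne.symm hx, Ne.symm hy⟩

variable [Fintype S]

/-- The condition `g q = u` says that `g * G⁻¹` fixes `u`, hence comes from a permutation of the
other symbols; `g = G` corresponds to the identity. -/
theorem image_ofSubtype_mul {u q : S} {G : Perm S} (hG : sign G = 1) (hGq : G q = u) :
    (fun h : Perm {x // x ≠ u} => ofSubtype h * G) '' {h | sign h = 1 ∧ h ≠ 1} =
      {g | sign g = 1 ∧ g q = u ∧ g ≠ G} := by
  ext g
  simp only [Set.mem_image, Set.mem_ofPred_eq]
  constructor
  · rintro ⟨h, ⟨hs, h1⟩, rfl⟩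
    refine ⟨by rw [Perm.sign_mul, sign_ofSubtype, hs, hG, one_mul], ?_, ?_⟩
    · rw [Perm.mul_apply, hGq, ofSubtype_apply_of_not_mem _ (by simp)]
    · intro h'
      exact h1 (ofSubtype_injective (by rw [map_one]; exact mul_eq_right.1 h'))
  · rintro ⟨hs, hq, hne⟩
    have hu : (g * G⁻¹) u = u := by
      rw [Perm.mul_apply, (Perm.inv_eq_iff_eq (f := G)).2 hGq.symm, hq]
    have h₁ : ∀ x, x ≠ u ↔ (g * G⁻¹) x ≠ u := fun x => by
      rw [Ne, Ne, not_iff_not, ← (g * G⁻¹).injective.eq_iff (a := x), hu]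
    have h₂ : ∀ x, (g * G⁻¹) x ≠ x → x ≠ u := by
      rintro x hx rfl; exact hx hu
    have h₃ : ofSubtype (subtypePerm (g * G⁻¹) (fun x => (h₁ x).symm)) = g * G⁻¹ :=
      ofSubtype_subtypePerm _ h₂
    refine ⟨subtypePerm (g * G⁻¹) (fun x => (h₁ x).symm), ⟨?_, ?_⟩, ?_⟩
    · rw [← sign_ofSubtype, h₃, Perm.sign_mul, Perm.sign_inv, hs, hG, one_mul]
    · intro h
      rw [h, map_one] at h₃
      exact hne (mul_inv_eq_one.1 h₃.symm)
    · rw [h₃, inv_mul_cancel_right]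

/-- Adding a symbol `u`: a hypertree on the even permutations of the other symbols, except the
identity, extends to one on the even permutations of index `q`, except a given one. -/
theorem HTree.add_symbol {a b u : S} (hab : a ≠ b) (ha : a ≠ u) (hb : b ≠ u) {φ : Perm S}
    (hφab : φ a ≠ b) {q : S} (hqa : q ≠ a) (hqb : q ≠ b) {G : Perm S} (hG : sign G = 1)
    (hGa : G a = a) (hGb : G b = b) (hGq : G q = u)
    (hS : HTree (Tri (⟨a, ha⟩ : {x // x ≠ u}) ⟨b, hb⟩) {h | sign h = 1 ∧ h ≠ 1}) :
    HTree (Tri a b) {g | sign g = 1 ∧ g q = slot φ u (g a) (g b) ∧ g ≠ G} := by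
  have h₀ := HTree.map (E' := Tri a b) (f := fun h => ofSubtype h * G)
    (fun h h' hh => ofSubtype_injective (mul_right_cancel hh)) (by
      -- Position `p` of `x` becomes position `G⁻¹ p`, while `a` and `b` stay in place; so 3-cycles
      -- go to 3-cycles by conjugation with `G`.
      have key : ∀ (x : Perm {x // x ≠ u}) (p : {x // x ≠ u}),
          ofSubtype (x * rot3 p ⟨a, ha⟩ ⟨b, hb⟩) * G = ofSubtype x * G * rot3 (G⁻¹ p) a b := by
        intro x p
        have h := conj_rot3 G (G⁻¹ p) a b
        rw [show G (G⁻¹ p) = p from (Equiv.eq_symm_apply G).1 rfl, hGa, hGb,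
          mul_inv_eq_iff_eq_mul] at h
        rw [mul_assoc, h, map_mul, rot3, map_mul, ofSubtype_swap_eq, ofSubtype_swap_eq, mul_assoc,
          rot3]
      have key' : ∀ (x : Perm {x // x ≠ u}) (p : {x // x ≠ u}),
          ofSubtype (x * (rot3 p ⟨a, ha⟩ ⟨b, hb⟩)⁻¹) * G =
            ofSubtype x * G * (rot3 (G⁻¹ p) a b)⁻¹ := by
        intro x p
        rw [eq_mul_inv_iff_mul_eq, ← key, inv_mul_cancel_right]
      rintro x y z ⟨p, hpa, hpb, h⟩
      refine ⟨G⁻¹ p, ?_, ?_, ?_⟩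
      · rw [Ne, Perm.inv_eq_iff_eq, hGa]
        exact fun h => hpa (Subtype.ext h)
      · rw [Ne, Perm.inv_eq_iff_eq, hGb]
        exact fun h => hpb (Subtype.ext h)
      · rcases h with ⟨rfl, rfl⟩ | ⟨rfl, rfl⟩
        · exact Or.inl ⟨key _ _, key' _ _⟩
        · exact Or.inr ⟨key _ _, key' _ _⟩) hS
  rw [image_ofSubtype_mul hG hGq] at h₀
  set c := rot3 q a b with hc
  have cq : c q = a := rot3_p hqb hqa
  have ca : c a = b := rot3_a hab hqb
  have cb : c b = q := rot3_b
  have cq' : c⁻¹ q = b := rot3_inv_p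
  have ca' : c⁻¹ a = q := rot3_inv_a hqb hqa
  have cb' : c⁻¹ b = a := rot3_inv_b hab hqb
  have cs : sign c = 1 := sign_rot3 hab hqa
  have hφi : ∀ {x y : S}, x = φ⁻¹ y ↔ φ x = y := fun {x y} => by
    rw [eq_comm, Perm.inv_eq_iff_eq, eq_comm]
  classical
  -- The other permutations of index `q` have `u` at `a` or at `b`. They pair up as `g * c⁻¹` and `g
  -- * c`, where `g q = u` and `g b = φ (g a)`, and each pair is attached to its `g`.
  have h := h₀.star (Finset.univ.filter fun g : Perm S => sign g = 1 ∧ g q = u ∧ g b = φ (g a))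
    (fun g => {g * c}) (fun g => {g * c⁻¹}) (fun _ _ => .single _) (fun _ _ => .single _)
    ?_ ?_ ?_ ?_
  · convert h using 1
    ext g
    simp only [Set.mem_ofPred_eq, Set.mem_union, Set.mem_iUnion, Finset.mem_filter,
      Finset.mem_univ, true_and, Set.mem_singleton_iff, exists_prop]
    constructor
    · rintro ⟨hs, hq, hne⟩
      by_cases hgb : g b = u
      · refine Or.inr ⟨g * c⁻¹, ⟨?_, ?_, ?_⟩, Or.inl (by group)⟩
        · rw [Perm.sign_mul, Perm.sign_inv, hs, cs, one_mul]
        · rw [Perm.mul_apply, cq', hgb]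
        · rw [Perm.mul_apply, Perm.mul_apply, cb', ca', hq, hgb, slot_right,
            Perm.coe_inv, Equiv.apply_symm_apply]
      by_cases hga : g a = u
      · refine Or.inr ⟨g * c, ⟨?_, ?_, ?_⟩, Or.inr (by group)⟩
        · rw [Perm.sign_mul, hs, cs, one_mul]
        · rw [Perm.mul_apply, cq, hga]
        · rw [Perm.mul_apply, Perm.mul_apply, cb, ca, hq, hga, slot_left hgb]
      · exact Or.inl ⟨hs, by rw [hq, slot_of_ne hga hgb], hne⟩
    · rintro (⟨hs, hq, hne⟩ | ⟨g, ⟨hs, hq, hgb⟩, rfl | rfl⟩)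
      · refine ⟨hs, ?_, hne⟩
        rw [hq, slot_of_ne]
        · rw [← hq]; exact g.injective.ne hqa.symm
        · rw [← hq]; exact g.injective.ne hqb.symm
      · refine ⟨by rw [Perm.sign_mul, hs, cs, one_mul], ?_, ?_⟩
        · rw [Perm.mul_apply, Perm.mul_apply, Perm.mul_apply, cq, ca, cb, hq, slot_right, hφi, hgb]
        · rintro rfl
          rw [Perm.mul_apply, cb, hq] at hGb
          exact hb hGb.symm
      · refine ⟨by rw [Perm.sign_mul, Perm.sign_inv, hs, cs, one_mul], ?_, ?_⟩
        · rw [Perm.mul_apply, Perm.mul_apply, Perm.mul_apply, cq', ca', cb', hq, slot_left, hgb]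
          rw [← hq]; exact g.injective.ne hqa.symm
        · rintro rfl
          rw [Perm.mul_apply, ca', hq] at hGa
          exact ha hGa.symm
  · intro g _
    rw [Set.disjoint_singleton]
    intro h
    have := congrArg (· a) (mul_left_cancel h)
    simp only [ca, ca'] at this
    exact hqb this.symm
  · simp only [Finset.mem_filter, Finset.mem_univ, true_and, Set.disjoint_union_right,
      Set.disjoint_singleton_right, Set.mem_ofPred_eq, Perm.mul_apply, cq, cq']
    rintro g ⟨-, hq, -⟩
    refine ⟨fun h => hqa (g.injective (hq.trans h.2.1.symm)), fun h =>
      hqb (g.injective (hq.trans h.2.1.symm))⟩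
  · simp only [Finset.mem_filter, Finset.mem_univ, true_and, Set.disjoint_union_right,
      Set.disjoint_union_left, Set.disjoint_singleton]
    rintro g ⟨-, hq, -⟩ g' ⟨-, hq', -⟩ hne
    refine ⟨⟨fun h => hne (mul_right_cancel h), fun h => ?_⟩, fun h => ?_,
      fun h => hne (mul_right_cancel h)⟩
    · have := congrArg (· b) h
      simp only [Perm.mul_apply, cb, cb'] at this
      exact hqa (g.injective (hq.trans (this.trans hq').symm))
    · have := congrArg (· b) h
      simp only [Perm.mul_apply, cb, cb'] at this
      exact hqa (g'.injective (hq'.trans (hq.symm.trans this)))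
  · simp only [Finset.mem_filter, Finset.mem_univ, true_and]
    rintro g ⟨hs, hq, hgb⟩
    refine ⟨g, ⟨hs, hq, ?_⟩, _, rfl, _, rfl, q, hqa, hqb, Or.inl ⟨rfl, rfl⟩⟩
    rintro rfl
    -- The omitted `G` is not needed as an attaching vertex, because `φ a ≠ b`.
    rw [hGa, hGb] at hgb
    exact hφab hgb.symm

end

/-! ### Auxiliary permutations -/

section

theorem exists_equiv_fin {S : Type*} [Fintype S] {m : ℕ} (hm : Fintype.card S = m + 2) {a b : S}
    (hab : a ≠ b) : ∃ e : S ≃ Fin (m + 2), e a = 1 ∧ e b = 0 := by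
  classical
  let e₀ : S ≃ Fin (m + 2) := Fintype.equivFinOfCardEq hm
  let e₁ := e₀.trans (swap (e₀ b) 0)
  have hb : e₁ b = 0 := by simp [e₁]
  have ha : e₁ a ≠ 0 := by rw [← hb]; exact e₁.injective.ne hab
  refine ⟨e₁.trans (swap (e₁ a) 1), by simp, ?_⟩
  rw [Equiv.trans_apply, hb, swap_apply_of_ne_of_ne ha.symm]
  simp

/-- Take one cycle through all of `S` in which `a` follows `b`: with at least four elements, neither
one nor two steps lead from `a` back to `b`. -/
theorem exists_perm_neighbours {S : Type*} [Fintype S] (hm : 4 ≤ Fintype.card S) {a b : S}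
    (hab : a ≠ b) : ∃ φ : Perm S, (∀ x, φ x ≠ x) ∧ φ a ≠ b ∧ φ (φ a) ≠ b := by
  obtain ⟨m, hm⟩ := Nat.exists_eq_add_of_le' hm
  obtain ⟨e, ha, hb⟩ := exists_equiv_fin (m := m + 2) hm hab
  have h : ∀ x, e.symm.permCongr (finRotate (m + 2 + 2)) x = e.symm (e x + 1) := by
    intro x; simp [Equiv.permCongr_apply]
  refine ⟨e.symm.permCongr (finRotate _), fun x => ?_, ?_, ?_⟩
  · rw [h, Ne, Equiv.symm_apply_eq]
    simp
  · rw [h, Ne, Equiv.symm_apply_eq, ha, hb, Fin.ext_iff]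
    simp only [Fin.val_add, Fin.val_one, Fin.val_zero]
    rw [Nat.mod_eq_of_lt (by omega)]
    omega
  · rw [h, h, Ne, Equiv.symm_apply_eq, Equiv.apply_symm_apply, ha, hb, Fin.ext_iff]
    simp only [Fin.val_add, Fin.val_one, Fin.val_zero, Nat.mod_add_mod]
    rw [Nat.mod_eq_of_lt (by omega)]
    omega

theorem exists_perm_forall_ne {S : Type*} [Fintype S] (hm : 2 ≤ Fintype.card S) :
    ∃ σ : Perm S, ∀ x, σ x ≠ x := by
  obtain ⟨m, hm⟩ := Nat.exists_eq_add_of_le' hm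
  let e : S ≃ Fin (m + 2) := Fintype.equivFinOfCardEq hm
  have h : ∀ x, e.symm.permCongr (finRotate (m + 2)) x = e.symm (e x + 1) := by
    intro x; simp [Equiv.permCongr_apply]
  refine ⟨e.symm.permCongr (finRotate _), fun x => ?_⟩
  rw [h, Ne, Equiv.symm_apply_eq]
  simp

variable {S : Type*} [DecidableEq S] [Fintype S]

/-- An even permutation with prescribed values at `a`, `b`, `j`, which maps the pair `{i, k}` onto
the pair `{d, e}`. -/
theorem exists_even_perm {a b i j u d e : S} (hia : i ≠ a) (hib : i ≠ b)
    (hij : i ≠ j) (hiu : i ≠ u) (hja : j ≠ a) (hjb : j ≠ b) (hju : j ≠ u) (hua : u ≠ a)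
    (hub : u ≠ b) (hda : d ≠ a) (hdb : d ≠ b) (hdu : d ≠ u) (hea : e ≠ a) (heb : e ≠ b)
    (heu : e ≠ u) (hde : d ≠ e) :
    ∃ G : Perm S, sign G = 1 ∧ G a = a ∧ G b = b ∧ G j = u ∧
      ((G i = d ∧ G u = e) ∨ (G i = e ∧ G u = d)) := by
  obtain ⟨G, ha, hb, hj, hi, hu⟩ :
      ∃ G : Perm S, G a = a ∧ G b = b ∧ G j = u ∧ G i = d ∧ G u = e := by
    let g₀ : Perm S := swap j u
    have h₀a : g₀ a = a := swap_apply_of_ne_of_ne hja.symm hua.symm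
    have h₀b : g₀ b = b := swap_apply_of_ne_of_ne hjb.symm hub.symm
    have h₀j : g₀ j = u := swap_apply_left _ _
    let g₁ : Perm S := swap (g₀ i) d * g₀
    have h₁ : ∀ x, x ≠ i → g₀ x ≠ d → g₁ x = g₀ x := fun x hx hd =>
      swap_apply_of_ne_of_ne (g₀.injective.ne hx) hd
    have h₁a : g₁ a = a := by rw [h₁ _ hia.symm (by rw [h₀a]; exact hda.symm), h₀a]
    have h₁b : g₁ b = b := by rw [h₁ _ hib.symm (by rw [h₀b]; exact hdb.symm), h₀b]
    have h₁j : g₁ j = u := by rw [h₁ _ hij.symm (by rw [h₀j]; exact hdu.symm), h₀j]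
    have h₁i : g₁ i = d := swap_apply_left _ _
    let g₂ : Perm S := swap (g₁ u) e * g₁
    have h₂ : ∀ x, x ≠ u → g₁ x ≠ e → g₂ x = g₁ x := fun x hx hd =>
      swap_apply_of_ne_of_ne (g₁.injective.ne hx) hd
    exact ⟨g₂, by rw [h₂ _ hua.symm (by rw [h₁a]; exact hea.symm), h₁a],
      by rw [h₂ _ hub.symm (by rw [h₁b]; exact heb.symm), h₁b],
      by rw [h₂ _ hju (by rw [h₁j]; exact heu.symm), h₁j],
      by rw [h₂ _ hiu (by rw [h₁i]; exact hde), h₁i], swap_apply_left _ _⟩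
  -- Exchanging the values `d` and `e` corrects the parity, which is why their order is left open.
  rcases Int.units_eq_one_or (sign G) with hs | hs
  · exact ⟨G, hs, ha, hb, hj, Or.inl ⟨hi, hu⟩⟩
  · refine ⟨swap d e * G, ?_, ?_, ?_, ?_, Or.inr ⟨?_, ?_⟩⟩
    · rw [Perm.sign_mul, hs, sign_swap hde]; rfl
    · rw [Perm.mul_apply, ha, swap_apply_of_ne_of_ne hda.symm hea.symm]
    · rw [Perm.mul_apply, hb, swap_apply_of_ne_of_ne hdb.symm heb.symm]
    · rw [Perm.mul_apply, hj, swap_apply_of_ne_of_ne hdu.symm heu.symm]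
    · rw [Perm.mul_apply, hi, swap_apply_left]
    · rw [Perm.mul_apply, hu, swap_apply_right]

theorem HTree.attach {V : Type*} {E : V → V → V → Prop} {A : Set V} (h : HTree E A) {x y z : V}
    (hx : x ∈ A) (hy : y ∉ A) (hz : z ∉ A) (hyz : y ≠ z) (hE : E x y z) :
    HTree E (A ∪ {y} ∪ {z}) :=
  .join h (.single y) (.single z) (Set.disjoint_singleton_right.2 hy)
    (Set.disjoint_singleton_right.2 hz) (Set.disjoint_singleton.2 hyz) hx rfl rfl hE

end

/-! ### Hypertrees on all even permutations but the identity -/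

theorem hTree_fin_four : HTree (Tri (0 : Fin 4) 1) {h | sign h = 1 ∧ h ≠ 1} := by
  have step : ∀ {A : Set (Perm (Fin 4))} (g : Perm (Fin 4)) (p : Fin 4), HTree (Tri 0 1) A →
      p ≠ 0 → p ≠ 1 → g ∈ A → g * rot3 p 0 1 ∉ A → g * (rot3 p 0 1)⁻¹ ∉ A →
      HTree (Tri 0 1) (A ∪ {g * rot3 p 0 1} ∪ {g * (rot3 p 0 1)⁻¹}) := by
    intro A g p hA h0 h1 hg hy hz
    refine hA.attach hg hy hz (fun h => h0 ?_) ⟨p, h0, h1, Or.inl ⟨rfl, rfl⟩⟩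
    have := congrArg (· 1) (mul_left_cancel h)
    simp only [rot3_b, rot3_inv_b (show (0 : Fin 4) ≠ 1 by decide) h1] at this
    exact this
  -- A seed and five pairs of leaves exhaust the 11 nonidentity elements of the alternating group.
  have s0 := HTree.single (E := Tri 0 1) (swap 0 1 * swap 2 3 : Perm (Fin 4))
  have s1 := step _ 3 s0 (by decide) (by decide) rfl (by rw [Set.mem_singleton_iff]; decide)
    (by rw [Set.mem_singleton_iff]; decide)
  have s2 := step _ 2 s1 (by decide) (by decide) (.inr rfl)
    (by simp only [Set.mem_union, Set.mem_singleton_iff]; decide)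
    (by simp only [Set.mem_union, Set.mem_singleton_iff]; decide)
  have s3 := step _ 3 s2 (by decide) (by decide) (.inr rfl)
    (by simp only [Set.mem_union, Set.mem_singleton_iff]; decide)
    (by simp only [Set.mem_union, Set.mem_singleton_iff]; decide)
  have s4 := step _ 2 s3 (by decide) (by decide) (.inl (.inl (.inl (.inl (.inl (.inr rfl))))))
    (by simp only [Set.mem_union, Set.mem_singleton_iff]; decide)
    (by simp only [Set.mem_union, Set.mem_singleton_iff]; decide)
  have s5 := step _ 3 s4 (by decide) (by decide) (.inl (.inr rfl))
    (by simp only [Set.mem_union, Set.mem_singleton_iff]; decide)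
    (by simp only [Set.mem_union, Set.mem_singleton_iff]; decide)
  convert s5 using 1
  ext g
  simp only [Set.mem_union, Set.mem_singleton_iff, Set.mem_ofPred_eq]
  revert g
  decide

theorem hTree_of_card_four {S : Type*} [DecidableEq S] [Fintype S] (hS : Fintype.card S = 4)
    {a b : S} (hab : a ≠ b) : HTree (Tri a b) {h | sign h = 1 ∧ h ≠ 1} := by
  obtain ⟨e, hb, ha⟩ := exists_equiv_fin (m := 2) hS hab.symm
  have hmul : ∀ g h, e.symm.permCongr (g * h) = e.symm.permCongr g * e.symm.permCongr h :=
    fun g h => map_mul e.symm.permCongrHom g h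
  have hinv : ∀ g, e.symm.permCongr g⁻¹ = (e.symm.permCongr g)⁻¹ :=
    fun g => map_inv e.symm.permCongrHom g
  have hrot : ∀ p, e.symm.permCongr (rot3 p 0 1) = rot3 (e.symm p) a b := by
    have hswap : ∀ i j, e.symm.permCongr (swap i j) = swap (e.symm i) (e.symm j) :=
      fun i j => Equiv.symm_trans_swap_trans i j e.symm
    intro p
    rw [rot3, rot3, hmul, hswap, hswap, (Equiv.symm_apply_eq e).2 ha.symm,
      (Equiv.symm_apply_eq e).2 hb.symm]
  have h := hTree_fin_four.map (E' := Tri a b) (f := e.symm.permCongr)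
    (Equiv.injective _) (by
      rintro x y z ⟨p, hpa, hpb, h⟩
      refine ⟨e.symm p, ?_, ?_, ?_⟩
      · rw [Ne, Equiv.symm_apply_eq, ha]; exact hpa
      · rw [Ne, Equiv.symm_apply_eq, hb]; exact hpb
      · rcases h with ⟨rfl, rfl⟩ | ⟨rfl, rfl⟩
        · exact Or.inl ⟨by rw [hmul, hrot], by rw [hmul, hinv, hrot]⟩
        · exact Or.inr ⟨by rw [hmul, hrot], by rw [hmul, hinv, hrot]⟩)
  convert h using 1
  ext g
  simp only [Set.mem_image_equiv, Set.mem_ofPred_eq, Equiv.permCongr_symm, Equiv.symm_symm,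
    sign_permCongr]
  refine and_congr_right fun _ => not_congr ?_
  rw [← e.permCongr.injective.eq_iff]
  exact iff_of_eq (congrArg _ (map_one e.permCongrHom))

section

variable {S : Type*} [DecidableEq S]

theorem exists_index {a b u : S} (hab : a ≠ b) {φ : Perm S} (hφu : φ u = u)
    (hφ : ∀ x, x ≠ u → φ x ≠ x) (g : Perm S) :
    ∃ q, q ≠ a ∧ q ≠ b ∧ g q = slot φ u (g a) (g b) := by
  obtain ⟨h₁, h₂⟩ := slot_ne (g.injective.ne hab) hφu hφ
  refine ⟨g⁻¹ (slot φ u (g a) (g b)), ?_, ?_, (Equiv.eq_symm_apply g).1 rfl⟩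
  · rwa [Ne, Perm.inv_eq_iff_eq]
  · rwa [Ne, Perm.inv_eq_iff_eq]

theorem exists_cyclic_perm [Fintype S] {u : S} (hS : 5 ≤ Fintype.card S) {a b : S} (hab : a ≠ b)
    (ha : a ≠ u) (hb : b ≠ u) :
    ∃ φ : Perm S, φ u = u ∧ (∀ x, x ≠ u → φ x ≠ x) ∧ φ a ≠ b ∧ φ (φ a) ≠ b := by
  have hcard : 4 ≤ Fintype.card {x // x ≠ u} := by
    rw [Fintype.card_subtype_compl, Fintype.card_subtype_eq]; omega
  obtain ⟨φ, h₁, h₂, h₃⟩ := exists_perm_neighbours hcard (a := ⟨a, ha⟩) (b := ⟨b, hb⟩)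
    (fun h => hab (congrArg Subtype.val h))
  have hval : ∀ x : {x // x ≠ u}, ofSubtype φ x = φ x := fun x => ofSubtype_apply_coe φ x
  refine ⟨ofSubtype φ, ofSubtype_apply_of_not_mem _ (by simp), fun x hx => ?_, ?_, ?_⟩
  · rw [hval ⟨x, hx⟩]
    exact fun h => h₁ _ (Subtype.ext h)
  · rw [hval ⟨a, ha⟩]
    exact fun h => h₂ (Subtype.ext h)
  · rw [hval ⟨a, ha⟩, hval]
    exact fun h => h₃ (Subtype.ext h)

end

/-- The even permutations other than the identity span a hypertree. -/
theorem hTree_even {m : ℕ} (hm : 4 ≤ m) : ∀ {S : Type*} [DecidableEq S] [Fintype S],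
    Fintype.card S = m → ∀ {a b : S}, a ≠ b → HTree (Tri a b) {h | sign h = 1 ∧ h ≠ 1} := by
  induction m, hm using Nat.le_induction with
  | base => intro S _ _ hS a b hab; exact hTree_of_card_four hS hab
  | succ m hm ih =>
    intro S _ _ hS a b hab
    have hcard3 : 2 ≤ Fintype.card {x : S // x ≠ a ∧ x ≠ b} := by
      have : Fintype.card {x : S // x ≠ a ∧ x ≠ b} = Fintype.card S - 2 := by
        rw [Fintype.card_subtype, ← Finset.card_pair hab, ← Finset.card_compl]
        congr 1
        ext x; simp
      omega
    obtain ⟨⟨u, hua, hub⟩⟩ : Nonempty {x : S // x ≠ a ∧ x ≠ b} :=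
      Fintype.card_pos_iff.1 (by omega)
    have hcardu : Fintype.card {x // x ≠ u} = m := by
      rw [Fintype.card_subtype_compl, Fintype.card_subtype_eq]; omega
    obtain ⟨φ, hφu, hφ, hφ₁, hφ₂⟩ := exists_cyclic_perm (u := u) (by omega) hab hua.symm hub.symm
    have hcard2 : 2 ≤ Fintype.card {x : S // x ≠ a ∧ x ≠ b ∧ x ≠ u} := by
      have : Fintype.card {x : S // x ≠ a ∧ x ≠ b ∧ x ≠ u} = Fintype.card S - 3 := by
        rw [Fintype.card_subtype, ← Finset.card_eq_three.2 ⟨a, b, u, hab, hua.symm, hub.symm, rfl⟩,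
          ← Finset.card_compl]
        congr 1
        ext x; simp
      omega
    obtain ⟨σ, hσ⟩ := exists_perm_forall_ne hcard2
    -- `d` is the slot for the entries `b`, `u` at the positions `a`, `b`, and `e` is the slot for
    -- the entries `u`, `a`.
    let d := φ⁻¹ b
    let e := φ a
    have hφd : φ d = b := (Equiv.eq_symm_apply φ).1 rfl
    have hda : d ≠ a := fun h => hφ₁ (by rw [← h, hφd])
    have hdb : d ≠ b := fun h => hφ b hub.symm (by rw [← h, hφd, h])
    have hdu : d ≠ u := fun h => hub (by rw [← hφd, h, hφu])
    have hea : e ≠ a := hφ a hua.symm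
    have heu : e ≠ u := fun h => hua (φ.injective (hφu.trans h.symm))
    have hde : d ≠ e := fun h => hφ₂ (by rw [← hφd, h])
    let I := {x : S // x ≠ a ∧ x ≠ b ∧ x ≠ u}
    -- `G i` has index `σ i`. Rotating its entries at `σ i`, `a`, `b` in the two directions produces
    -- the slots `d` and `e`, which `G i` carries at the positions `i` and `u`. Thus its hyperedge
    -- meets the indices `σ i`, `i` and `u`.
    have hG : ∀ i : I, ∃ G : Perm S, sign G = 1 ∧ G a = a ∧ G b = b ∧ G (σ i) = u ∧
        ((G i = d ∧ G u = e) ∨ (G i = e ∧ G u = d)) := fun i =>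
      exists_even_perm i.2.1 i.2.2.1 (fun h => hσ i (Subtype.ext h.symm)) i.2.2.2 (σ i).2.1
        (σ i).2.2.1 (σ i).2.2.2 hua hub hda hdb hdu hea hφ₁ heu hde
    choose G hGs hGa hGb hGu hGi using hG
    let W : S → Set (Perm S) := fun q => {g | sign g = 1 ∧ g q = slot φ u (g a) (g b)}
    have hW : ∀ {q q' g}, g ∈ W q → g ∈ W q' → q = q' := fun {q q' g} h h' =>
      g.injective (h.2.trans h'.2.symm)
    have hGW : ∀ i, G i ∈ W (σ i) := fun i =>
      ⟨hGs i, by rw [hGa, hGb, hGu, slot_of_ne hua.symm hub.symm]⟩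
    have h1W : (1 : Perm S) ∈ W u := ⟨sign_one, by
      rw [Perm.one_apply, Perm.one_apply, Perm.one_apply, slot_of_ne hua.symm hub.symm]⟩
    have ht : ∀ {q : S} {H : Perm S}, q ≠ a → q ≠ b → sign H = 1 → H a = a → H b = b → H q = u →
        HTree (Tri a b) (W q \ {H}) := by
      intro q H hqa hqb hs ha hb hq
      have h := HTree.add_symbol hab hua.symm hub.symm (φ := φ) hφ₁ hqa hqb hs ha hb hq
        (ih hcardu (fun h => hab (congrArg Subtype.val h)))
      convert h using 1
      ext g
      simp only [W, Set.mem_sdiff, Set.mem_ofPred_eq, Set.mem_singleton_iff, and_assoc]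
    -- The centre has index `u` and lacks the identity. The class of index `i` is attached without
    -- `G (σ.symm i)`, and the single vertex `G i` supplies what the class of index `σ i` lacks. The
    -- derangement `σ` keeps `G i` out of the class attached along with it.
    have h := (ht hua hub sign_one rfl rfl rfl).star Finset.univ
      (fun i : I => W i \ {G (σ.symm i)}) (fun i : I => {G i})
      (fun i _ => ht i.2.1 i.2.2.1 (hGs _) (hGa _) (hGb _)
        (by have := hGu (σ.symm i); rwa [Equiv.apply_symm_apply] at this))
      (fun _ _ => .single _) ?_ ?_ ?_ ?_
    · convert h using 1
      ext g
      simp only [Set.mem_ofPred_eq, Set.mem_union, Set.mem_iUnion, Finset.mem_univ, Set.mem_sdiff,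
        Set.mem_singleton_iff, exists_const]
      constructor
      · rintro ⟨hs, h1⟩
        obtain ⟨q, hqa, hqb, hq⟩ := exists_index hab hφu hφ g
        by_cases hqu : q = u
        · subst hqu; exact Or.inl ⟨⟨hs, hq⟩, h1⟩
        let i : I := ⟨q, hqa, hqb, hqu⟩
        by_cases hgi : g = G (σ.symm i)
        · exact Or.inr ⟨_, Or.inr hgi⟩
        · exact Or.inr ⟨i, Or.inl ⟨⟨hs, hq⟩, hgi⟩⟩
      · rintro (⟨hg, h1⟩ | ⟨i, ⟨hg, -⟩ | rfl⟩)
        · exact ⟨hg.1, h1⟩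
        · exact ⟨hg.1, fun h => i.2.2.2 (hW (h ▸ hg) h1W)⟩
        · exact ⟨hGs i, fun h => (σ i).2.2.2 (hW (hGW i) (h ▸ h1W))⟩
    · intro i _
      rw [Set.disjoint_singleton_right]
      exact fun h => hσ i (Subtype.ext (hW (hGW i) h.1))
    · intro i _
      rw [Set.disjoint_left]
      rintro g ⟨hg, -⟩ (⟨hg', -⟩ | rfl)
      · exact i.2.2.2 (hW hg' hg)
      · exact (σ i).2.2.2 (hW (hGW i) hg)
    · intro i _ j _ hij
      rw [Set.disjoint_left]
      rintro g (⟨hg, hne⟩ | rfl) (⟨hg', hne'⟩ | hg')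
      · exact hij (Subtype.ext (hW hg hg'))
      · obtain rfl : g = G j := hg'
        have : i = σ j := Subtype.ext (hW hg (hGW j))
        exact hne (by rw [this, Equiv.symm_apply_apply]; rfl)
      · have : j = σ i := Subtype.ext (hW hg' (hGW i))
        exact hne' (by rw [this, Equiv.symm_apply_apply]; rfl)
      · have hg' : G i = G j := hg'
        exact hij (σ.injective (Subtype.ext (hW (hGW i) (hg' ▸ hGW j))))
    · intro i _
      have hqa := (σ i).2.1
      have hqb := (σ i).2.2.1
      have hiq : (i : S) ≠ σ i := fun h => hσ i (Subtype.ext h.symm)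
      set c := rot3 (σ i : S) a b with hc
      have cs : sign c = 1 := sign_rot3 hab hqa
      have mem₁ : ∀ q, q ≠ a → q ≠ b → q ≠ σ i → G i q = d → G i * c ∈ W q := by
        intro q ha hb hq hd
        refine ⟨by rw [Perm.sign_mul, hGs, cs, one_mul], ?_⟩
        rw [Perm.mul_apply, Perm.mul_apply, Perm.mul_apply, rot3_of_ne hq ha hb, rot3_a hab hqb,
          rot3_b, hd, hGb, hGu, slot_right]
      have mem₂ : ∀ q, q ≠ a → q ≠ b → q ≠ σ i → G i q = e → G i * c⁻¹ ∈ W q := by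
        intro q ha hb hq he
        refine ⟨by rw [Perm.sign_mul, Perm.sign_inv, hGs, cs, one_mul], ?_⟩
        rw [Perm.mul_apply, Perm.mul_apply, Perm.mul_apply, rot3_inv_of_ne hq ha hb,
          rot3_inv_a hqb hqa, rot3_inv_b hab hqb, he, hGa, hGu, slot_left hua.symm]
      have ne₁ : ∀ H : Perm S, H b = b → G i * c ≠ H := by
        rintro H hH rfl
        rw [Perm.mul_apply, rot3_b, hGu] at hH
        exact hub hH
      have ne₂ : ∀ H : Perm S, H a = a → G i * c⁻¹ ≠ H := by
        rintro H hH rfl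
        rw [Perm.mul_apply, rot3_inv_a hqb hqa, hGu] at hH
        exact hua hH
      have hE : Tri a b (G i) (G i * c) (G i * c⁻¹) := ⟨σ i, hqa, hqb, Or.inl ⟨rfl, rfl⟩⟩
      have huq : u ≠ σ i := (σ i).2.2.2.symm
      -- The order of `d` and `e` in `G i` decides which rotation has index `u` and which has index
      -- `i`.
      rcases hGi i with ⟨hi, hu⟩ | ⟨hi, hu⟩
      · exact ⟨_, ⟨mem₂ u hua hub huq hu, ne₂ 1 rfl⟩, _,
          ⟨mem₁ i i.2.1 i.2.2.1 hiq hi, ne₁ _ (hGb _)⟩, _, rfl, ((hE.rotate hab).rotate hab).swap⟩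
      · exact ⟨_, ⟨mem₁ u hua hub huq hu, ne₁ 1 rfl⟩, _,
          ⟨mem₂ i i.2.1 i.2.2.1 hiq hi, ne₂ _ (hGa _)⟩, _, rfl, hE.rotate hab⟩

/-! ### From hypertrees to cyclic lists -/

/-- The list `t`, read cyclically, is a chain for the relation `R`. -/
def IsCyclicChain {α : Type*} (R : α → α → Prop) (t : List α) : Prop :=
  t.IsChain R ∧ ∀ x ∈ t.getLast?, ∀ y ∈ t.head?, R x y

/-- Cut the cyclic list just after `y`. -/
theorem IsCyclicChain.exists_getLast?_eq {α : Type*} {R : α → α → Prop} {t : List α}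
    (h : IsCyclicChain R t) {y : α} (hy : y ∈ t) :
    ∃ t' : List α, t'.Perm t ∧ IsCyclicChain R t' ∧ t'.getLast? = some y := by
  obtain ⟨l₁, l₂, rfl⟩ := List.append_of_mem hy
  obtain ⟨h, hc⟩ := h
  have hl : l₁ ++ y :: l₂ = (l₁ ++ [y]) ++ l₂ := by simp
  rw [hl] at h hc ⊢
  obtain ⟨h₁, h₂, h₁₂⟩ := List.isChain_append.1 h
  have hlast : (l₁ ++ [y]).getLast? = some y := by simp
  refine ⟨l₂ ++ (l₁ ++ [y]), List.perm_append_comm, ⟨List.isChain_append.2 ⟨h₂, h₁, ?_⟩, ?_⟩,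
    by simp⟩
  · intro x hx z hz
    refine hc x ?_ z ?_
    · rw [List.getLast?_append, Option.mem_def.1 hx]; rfl
    · rw [List.head?_append, Option.mem_def.1 hz]; rfl
  · intro x hx z hz
    rw [List.getLast?_append, hlast] at hx
    obtain rfl : y = x := Option.some.inj hx
    cases l₂ with
    | nil => exact hc y (by simp) z (by simpa using hz)
    | cons w l₂ => exact h₁₂ y hlast z hz

section

variable {Γ : Type*} [Group Γ]

/-- The union of the left cosets of the powers of `B` that meet `V`. -/
def sat (B : Γ) (V : Set Γ) : Set Γ := {x | ∃ v ∈ V, ∃ i : ℤ, x = v * B ^ i}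

theorem sat_union (B : Γ) (V W : Set Γ) : sat B (V ∪ W) = sat B V ∪ sat B W := by
  ext x
  simp only [sat, Set.mem_ofPred_eq, Set.mem_union]
  constructor
  · rintro ⟨v, hv | hv, i, rfl⟩
    exacts [Or.inl ⟨v, hv, i, rfl⟩, Or.inr ⟨v, hv, i, rfl⟩]
  · rintro (⟨v, hv, i, rfl⟩ | ⟨v, hv, i, rfl⟩)
    exacts [⟨v, Or.inl hv, i, rfl⟩, ⟨v, Or.inr hv, i, rfl⟩]

/-- `hT` says that `T` meets each coset of the powers of `B` at most once. -/
theorem disjoint_sat {B : Γ} {T V W : Set Γ} (hT : ∀ v ∈ T, ∀ w ∈ T, ∀ i : ℤ, w = v * B ^ i → w = v)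
    (hV : V ⊆ T) (hW : W ⊆ T) (h : Disjoint V W) : Disjoint (sat B V) (sat B W) := by
  rw [Set.disjoint_left]
  rintro _ ⟨v, hv, i, rfl⟩ ⟨w, hw, j, hij⟩
  have : w = v * B ^ (i - j) := by rw [zpow_sub, ← mul_assoc, hij, mul_inv_cancel_right]
  exact Set.disjoint_left.1 h hv (hT v (hV hv) w (hW hw) _ this ▸ hw)

/-- A transition by `B`, or by `A` from an element whose coset modulo `A * B⁻¹` lies in `U`. -/
def Transition (A B : Γ) (U : Set Γ) (x y : Γ) : Prop :=
  y = x * B ∨ (y = x * A ∧ ∀ k : ℕ, x * (A * B⁻¹) ^ k ∈ U)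

theorem Transition.mono {A B : Γ} {U U' : Set Γ} (hU : U ⊆ U') {x y : Γ}
    (h : Transition A B U x y) : Transition A B U' x y :=
  h.imp_right fun h => ⟨h.1, fun k => hU (h.2 k)⟩

/-- The hyperedges that consist of `x`, `x * d`, `x * d²` up to conjugation by powers of `B`, where
`d = A * B⁻¹`. -/
def CosetTriple (A B x y z : Γ) : Prop :=
  ∃ i : ℤ, (y * B ^ i = x * B ^ i * (A * B⁻¹) ∧ z * B ^ i = x * B ^ i * (A * B⁻¹) ^ 2) ∨
    (z * B ^ i = x * B ^ i * (A * B⁻¹) ∧ y * B ^ i = x * B ^ i * (A * B⁻¹) ^ 2)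

theorem exists_list_single (A : Γ) {B : Γ} (hB : IsOfFinOrder B) (v : Γ) :
    ∃ t : List Γ, t.Nodup ∧ (∀ x, x ∈ t ↔ x ∈ sat B {v}) ∧
      IsCyclicChain (Transition A B (sat B {v})) t := by
  have hpos := hB.orderOf_pos
  refine ⟨(List.range (orderOf B)).map fun i => v * B ^ i, ?_, ?_, ?_, ?_⟩
  · refine List.Nodup.map_on (fun i hi j hj hij => ?_) List.nodup_range
    exact pow_injOn_Iio_orderOf (List.mem_range.1 hi) (List.mem_range.1 hj) (mul_left_cancel hij)
  · intro x
    simp only [List.mem_map, List.mem_range, sat, Set.mem_ofPred_eq, Set.mem_singleton_iff,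
      exists_eq_left]
    constructor
    · rintro ⟨i, -, rfl⟩
      exact ⟨i, by rw [zpow_natCast]⟩
    · rintro ⟨i, rfl⟩
      have h0 : (0 : ℤ) < orderOf B := by exact_mod_cast hpos
      refine ⟨(i % (orderOf B : ℤ)).toNat, ?_, ?_⟩
      · have := Int.emod_lt_of_pos i h0
        have := Int.emod_nonneg i h0.ne'
        omega
      · rw [← zpow_natCast, Int.toNat_of_nonneg (Int.emod_nonneg i h0.ne'), zpow_mod_orderOf]
  · rw [List.isChain_iff_getElem]
    intro i hi
    left
    simp only [List.getElem_map, List.getElem_range, pow_succ, mul_assoc]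
  · intro x hx y hy
    left
    obtain ⟨N, hN⟩ := Nat.exists_eq_succ_of_ne_zero hpos.ne'
    have h := pow_orderOf_eq_one B
    rw [hN] at hx hy h
    rw [List.range_succ_eq_map] at hy
    rw [List.range_succ] at hx
    simp at hx hy
    rw [← hx, ← hy, mul_assoc, ← pow_succ, h, mul_one]

/-- Cut after `y`, `y * d` and `y * d ^ 2`, the tours start at `y * B`, `y * d * B` and `y * d ^ 2 *
B`. A step by `A` leads from the end of each to the start of the next, and the last returns to the
first because `d ^ 3 = 1`. -/
theorem IsCyclicChain.merge {A B : Γ} (hd : (A * B⁻¹) ^ 3 = 1) {U₁ U₂ U₃ : Set Γ}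
    (h₁₂ : Disjoint U₁ U₂) (h₁₃ : Disjoint U₁ U₃) (h₂₃ : Disjoint U₂ U₃) {y : Γ} (hy₁ : y ∈ U₁)
    (hy₂ : y * (A * B⁻¹) ∈ U₂) (hy₃ : y * (A * B⁻¹) ^ 2 ∈ U₃)
    (h₁ : ∃ t : List Γ, t.Nodup ∧ (∀ x, x ∈ t ↔ x ∈ U₁) ∧ IsCyclicChain (Transition A B U₁) t)
    (h₂ : ∃ t : List Γ, t.Nodup ∧ (∀ x, x ∈ t ↔ x ∈ U₂) ∧ IsCyclicChain (Transition A B U₂) t)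
    (h₃ : ∃ t : List Γ, t.Nodup ∧ (∀ x, x ∈ t ↔ x ∈ U₃) ∧ IsCyclicChain (Transition A B U₃) t) :
    ∃ t : List Γ, t.Nodup ∧ (∀ x, x ∈ t ↔ x ∈ U₁ ∪ U₂ ∪ U₃) ∧
      IsCyclicChain (Transition A B (U₁ ∪ U₂ ∪ U₃)) t := by
  set d := A * B⁻¹ with hd'
  have hA : A = d * B := by rw [hd', inv_mul_cancel_right]
  -- `Transition` allows `A` only when the whole coset of `d` lies in `U`; since `y * d ∉ U`, the
  -- step out of `y` must be by `B`.
  have key : ∀ {U : Set Γ} {y : Γ}, y ∈ U → y * d ∉ U → U ⊆ U₁ ∪ U₂ ∪ U₃ →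
      (∃ t : List Γ, t.Nodup ∧ (∀ x, x ∈ t ↔ x ∈ U) ∧ IsCyclicChain (Transition A B U) t) →
      ∃ t : List Γ, t.Nodup ∧ (∀ x, x ∈ t ↔ x ∈ U) ∧
        t.IsChain (Transition A B (U₁ ∪ U₂ ∪ U₃)) ∧ t.getLast? = some y ∧
        t.head? = some (y * B) := by
    rintro U y hy hyd hU ⟨t, hnd, hmem, ht⟩
    obtain ⟨t', hp, ⟨hc, hcl⟩, hlast⟩ := ht.exists_getLast?_eq ((hmem y).2 hy)
    refine ⟨t', hp.nodup_iff.2 hnd, fun x => hp.mem_iff.trans (hmem x),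
      hc.imp fun _ _ h => h.mono hU, hlast, ?_⟩
    obtain ⟨h, hh⟩ : ∃ h, t'.head? = some h := by
      cases t' with
      | nil => simp at hlast
      | cons h _ => exact ⟨h, rfl⟩
    rcases hcl y hlast h hh with rfl | ⟨-, hk⟩
    · exact hh
    · exact absurd (by simpa using hk 1) hyd
  -- The new steps by `A` are admissible in the union, which contains all of `y`, `y * d`, `y * d ^
  -- 2`. This keeps the invariant of `Transition`.
  have hcos : ∀ {y' : Γ} (k : ℕ), y' = y * d ^ k → ∀ j : ℕ, y' * d ^ j ∈ U₁ ∪ U₂ ∪ U₃ := by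
    rintro _ k rfl j
    rw [mul_assoc, ← pow_add, ← Nat.div_add_mod (k + j) 3, pow_add, pow_mul, hd, one_pow, one_mul]
    have := Nat.mod_lt (k + j) (show 0 < 3 by norm_num)
    interval_cases (k + j) % 3
    · exact Or.inl (Or.inl (by simpa using hy₁))
    · exact Or.inl (Or.inr (by simpa using hy₂))
    · exact Or.inr hy₃
  have hd3 : y * d ^ 2 * d = y := by rw [mul_assoc, ← pow_succ, hd, mul_one]
  have hd2 : y * d * d = y * d ^ 2 := by rw [mul_assoc, ← pow_two]
  obtain ⟨t₁, n₁, m₁, c₁, l₁, f₁⟩ := key hy₁ (Set.disjoint_right.1 h₁₂ hy₂)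
    (fun x hx => Or.inl (Or.inl hx)) h₁
  obtain ⟨t₂, n₂, m₂, c₂, l₂, f₂⟩ := key hy₂
    (by rw [hd2]; exact Set.disjoint_right.1 h₂₃ hy₃) (fun x hx => Or.inl (Or.inr hx)) h₂
  obtain ⟨t₃, n₃, m₃, c₃, l₃, f₃⟩ := key hy₃
    (by rw [hd3]; exact Set.disjoint_left.1 h₁₃ hy₁) (fun x hx => Or.inr hx) h₃
  refine ⟨t₁ ++ (t₂ ++ t₃), ?_, ?_, ?_, ?_⟩
  · rw [List.nodup_append', List.nodup_append']
    refine ⟨n₁, ⟨n₂, n₃, ?_⟩, ?_⟩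
    · intro x h h'
      exact Set.disjoint_left.1 h₂₃ ((m₂ x).1 h) ((m₃ x).1 h')
    · intro x h h'
      rcases List.mem_append.1 h' with h' | h'
      · exact Set.disjoint_left.1 h₁₂ ((m₁ x).1 h) ((m₂ x).1 h')
      · exact Set.disjoint_left.1 h₁₃ ((m₁ x).1 h) ((m₃ x).1 h')
  · intro x
    rw [List.mem_append, List.mem_append, m₁, m₂, m₃, Set.mem_union, Set.mem_union, or_assoc]
  · rw [List.isChain_append, List.isChain_append, List.head?_append, f₂, l₁, l₂, f₃]
    refine ⟨c₁, ⟨c₂, c₃, ?_⟩, ?_⟩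
    · rintro _ ⟨⟩ _ ⟨⟩
      exact Or.inr ⟨by rw [hA, ← hd2]; group, hcos 1 (by rw [pow_one])⟩
    · rintro _ ⟨⟩ _ ⟨⟩
      exact Or.inr ⟨by rw [hA]; group, hcos 0 (by rw [pow_zero, mul_one])⟩
  · rw [List.getLast?_append, List.getLast?_append, l₃, List.head?_append, f₁]
    rintro _ ⟨⟩ _ ⟨⟩
    exact Or.inr ⟨by rw [hA, ← mul_assoc, hd3], hcos 2 rfl⟩

theorem HTree.exists_cyclic_list {A B : Γ} (hd : (A * B⁻¹) ^ 3 = 1) (hB : IsOfFinOrder B)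
    {T : Set Γ} (hT : ∀ v ∈ T, ∀ w ∈ T, ∀ i : ℤ, w = v * B ^ i → w = v) {V : Set Γ}
    (hV : HTree (CosetTriple A B) V) (hVT : V ⊆ T) :
    ∃ t : List Γ, t.Nodup ∧ (∀ x, x ∈ t ↔ x ∈ sat B V) ∧
      IsCyclicChain (Transition A B (sat B V)) t := by
  induction hV with
  | single v => exact exists_list_single A hB v
  | @join V₁ V₂ V₃ x y z _ _ _ h₁₂ h₁₃ h₂₃ hx hy hz hE ih₁ ih₂ ih₃ =>
    have s₁ : V₁ ⊆ T := fun v hv => hVT (Or.inl (Or.inl hv))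
    have s₂ : V₂ ⊆ T := fun v hv => hVT (Or.inl (Or.inr hv))
    have s₃ : V₃ ⊆ T := fun v hv => hVT (Or.inr hv)
    rw [sat_union, sat_union]
    obtain ⟨i, ⟨hy', hz'⟩ | ⟨hz', hy'⟩⟩ := hE
    · exact IsCyclicChain.merge hd (disjoint_sat hT s₁ s₂ h₁₂) (disjoint_sat hT s₁ s₃ h₁₃)
        (disjoint_sat hT s₂ s₃ h₂₃) (y := x * B ^ i) ⟨x, hx, i, rfl⟩ ⟨y, hy, i, hy'.symm⟩
        ⟨z, hz, i, hz'.symm⟩ (ih₁ s₁) (ih₂ s₂) (ih₃ s₃)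
    · rw [Set.union_right_comm]
      exact IsCyclicChain.merge hd (disjoint_sat hT s₁ s₃ h₁₃) (disjoint_sat hT s₁ s₂ h₁₂)
        (disjoint_sat hT s₂ s₃ h₂₃).symm (y := x * B ^ i) ⟨x, hx, i, rfl⟩ ⟨z, hz, i, hz'.symm⟩
        ⟨y, hy, i, hy'.symm⟩ (ih₁ s₁) (ih₃ s₃) (ih₂ s₂)

end

/-! ### The snake -/

/-- The transitions `A` and `B` admit a cyclic list of all even permutations but one coset of the
powers of `B`. -/
theorem exists_cyclic_list_even {S : Type*} [DecidableEq S] [Fintype S] (hS : 5 ≤ Fintype.card S)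
    {a b q : S} (hab : a ≠ b) (hqa : q ≠ a) (hqb : q ≠ b) {A B : Perm S} (hBa : B a = a)
    (hBb : B b = b) (hBs : sign B = 1) (hBq : ∀ p, p ≠ a → p ≠ b → ∃ i : ℤ, (B ^ i) q = p)
    (hAB : A * B⁻¹ = (rot3 q a b)⁻¹) :
    ∃ t : List (Perm S), t.Nodup ∧ t.length = (Fintype.card S).factorial / 2 - orderOf B ∧
      (∀ x ∈ t, sign x = 1) ∧ IsCyclicChain (fun x y => y = x * B ∨ y = x * A) t := by
  classical
  have hsq := rot3_mul_self hab hqb hqa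
  have hd3 : (rot3 q a b)⁻¹ ^ 3 = 1 := by
    rw [pow_succ, pow_two, ← mul_inv_rev, hsq, inv_inv, mul_inv_cancel]
  have hd2 : (rot3 q a b)⁻¹ ^ 2 = rot3 q a b := by
    rw [pow_two, ← mul_inv_rev, hsq, inv_inv]
  obtain ⟨φ, hφu, hφ, hφ₁, -⟩ := exists_cyclic_perm hS hab hqa.symm hqb.symm
  have hcard : Fintype.card {x // x ≠ q} = Fintype.card S - 1 := by
    rw [Fintype.card_subtype_compl, Fintype.card_subtype_eq]
  have hfix : ∀ {x : S}, B x = x → ∀ i : ℤ, (B ^ i) x = x := fun h i =>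
    zpow_apply_eq_self_of_apply_eq_self h i
  let T : Set (Perm S) := {g | sign g = 1 ∧ g q = slot φ q (g a) (g b)}
  -- `B ^ i` preserves the entries at `a`, `b` and so the slot; equal indices force `B ^ i` to fix
  -- `q`, hence everything, as `B` is transitive off `a`, `b`.
  have hT : ∀ v ∈ T, ∀ w ∈ T, ∀ i : ℤ, w = v * B ^ i → w = v := by
    rintro v ⟨-, hv⟩ w ⟨-, hw⟩ i rfl
    rw [Perm.mul_apply, Perm.mul_apply, Perm.mul_apply, hfix hBa, hfix hBb, ← hv] at hw
    have hq := v.injective hw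
    suffices B ^ i = 1 by rw [this, mul_one]
    ext x
    rw [Perm.one_apply]
    by_cases hxa : x = a
    · rw [hxa, hfix hBa]
    by_cases hxb : x = b
    · rw [hxb, hfix hBb]
    obtain ⟨j, rfl⟩ := hBq x hxa hxb
    rw [← Perm.mul_apply, ← zpow_add, add_comm, zpow_add, Perm.mul_apply, hq]
  have h1T : (1 : Perm S) ∈ T := ⟨sign_one, by
    rw [Perm.one_apply, Perm.one_apply, Perm.one_apply, slot_of_ne hqa.symm hqb.symm]⟩
  -- The position `q` also serves as the inserted symbol, with the identity as the omitted
  -- permutation.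
  have htree : HTree (CosetTriple A B) (T \ {1}) := by
    have h := HTree.add_symbol hab hqa.symm hqb.symm hφ₁ hqa hqb sign_one rfl rfl rfl
      (hTree_even (by omega) hcard (fun h => hab (congrArg Subtype.val h)))
    -- Conjugation by a power of `B` carries `q` to any third position, so each hyperedge is a
    -- `CosetTriple`.
    have h := h.map (E' := CosetTriple A B) (f := id) Function.injective_id (by
      rintro x y z ⟨p, hpa, hpb, h⟩
      obtain ⟨j, hj⟩ := hBq p hpa hpb
      have hc := conj_rot3 (B ^ j) q a b
      rw [hj, hfix hBa, hfix hBb] at hc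
      refine ⟨j, ?_⟩
      simp only [id, hAB, hd2]
      rcases h with ⟨rfl, rfl⟩ | ⟨rfl, rfl⟩
      · exact Or.inr ⟨by rw [← hc]; group, by rw [← hc]; group⟩
      · exact Or.inl ⟨by rw [← hc]; group, by rw [← hc]; group⟩)
    convert h using 1
    ext g
    simp only [T, Set.image_id, Set.mem_sdiff, Set.mem_ofPred_eq, Set.mem_singleton_iff, and_assoc]
  obtain ⟨t, hnd, hmem, ht⟩ := htree.exists_cyclic_list (by rw [hAB, hd3]) (isOfFinOrder_of_finite B)
    hT Set.sdiff_subset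
  -- Dropping the representative `1` drops exactly the subgroup generated by `B`.
  have hmem' : ∀ x, x ∈ t ↔ sign x = 1 ∧ x ∉ Subgroup.zpowers B := by
    intro x
    rw [hmem]
    constructor
    · rintro ⟨v, ⟨hv, hv1⟩, i, rfl⟩
      refine ⟨by rw [Perm.sign_mul, map_zpow, hBs, one_zpow, mul_one, hv.1], ?_⟩
      rintro ⟨j, hj⟩
      have hj : B ^ j = v * B ^ i := hj
      refine hv1 (hT 1 h1T v hv (j - i) ?_)
      rw [zpow_sub, hj, one_mul, mul_inv_cancel_right]
    · rintro ⟨hs, hx⟩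
      obtain ⟨p, hpa, hpb, hp⟩ := exists_index hab hφu hφ x
      obtain ⟨i, hi⟩ := hBq p hpa hpb
      refine ⟨x * B ^ i, ⟨⟨?_, ?_⟩, ?_⟩, -i, ?_⟩
      · rw [Perm.sign_mul, map_zpow, hBs, one_zpow, mul_one, hs]
      · rw [Perm.mul_apply, Perm.mul_apply, Perm.mul_apply, hfix hBa, hfix hBb, hi, hp]
      · intro h
        exact hx ⟨-i, (zpow_neg B i).trans (eq_inv_of_mul_eq_one_left h).symm⟩
      · rw [zpow_neg, mul_inv_cancel_right]
  refine ⟨t, hnd, ?_, fun x hx => ((hmem' x).1 hx).1, ht.1.imp fun x y h => ?_, fun x hx y hy => ?_⟩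
  · have : Nontrivial S := ⟨a, b, hab⟩
    have h₁ : t.toFinset = (Finset.univ.filter fun x : Perm S => x ∈ alternatingGroup S) \
        (Finset.univ.filter fun x : Perm S => x ∈ Subgroup.zpowers B) := by
      ext x
      simp [hmem', mem_alternatingGroup]
    rw [← List.toFinset_card_of_nodup hnd, h₁, Finset.card_sdiff_of_subset,
      ← Fintype.card_subtype, ← Fintype.card_subtype, ← Fintype.card_zpowers, ← card_alternatingGroup]
    intro x
    simp only [Finset.mem_filter, Finset.mem_univ, true_and]
    rintro ⟨i, rfl⟩
    rw [mem_alternatingGroup, map_zpow, hBs, one_zpow]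
  · exact h.imp_right And.left
  · exact (ht.2 x hx y hy).imp_right And.left

/-! ### Gray codes and Kendall's distance -/

theorem IsCyclicChain.isGrayCode {α : Type*} {R : α → α → Prop} {T : Set (α → α)}
    (hR : ∀ x y, R x y → ∃ t ∈ T, y = t x) {t : List α} (ht : IsCyclicChain R t) (hnd : t.Nodup) :
    IsGrayCode T t.get := by
  refine ⟨List.nodup_iff_injective_get.1 hnd, fun j => hR _ _ ?_⟩
  obtain ⟨N, hN⟩ := Nat.exists_eq_succ_of_ne_zero (Fin.pos j).ne'
  have hrot : ((finRotate t.length j : Fin _) : ℕ) = if (j : ℕ) = N then 0 else (j : ℕ) + 1 := by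
    have : ∀ (K : ℕ) (h : K = N + 1) (j : Fin K),
        ((finRotate K j : Fin _) : ℕ) = if (j : ℕ) = N then 0 else (j : ℕ) + 1 := by
      rintro _ rfl j
      rw [coe_finRotate]
      simp only [Fin.ext_iff, Fin.val_last]
    exact this _ hN j
  rw [List.get_eq_getElem, List.get_eq_getElem]
  simp only [hrot]
  by_cases hj : (j : ℕ) = N
  · simp only [hj, if_true]
    refine ht.2 _ ?_ _ ?_
    · rw [List.getLast?_eq_getElem?, show t.length - 1 = N by omega]
      simp
    · rw [List.head?_eq_getElem?]
      simp
  · simp only [hj, if_false]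
    exact List.isChain_iff_getElem.1 ht.1 j (by have := j.2; omega)

theorem sign_list_prod {m : ℕ} {l : List (Perm (Fin m))} (hl : ∀ s ∈ l, IsAdjacentTransposition s) :
    sign l.prod = (-1) ^ l.length := by
  induction l with
  | nil => simp
  | cons s l ih =>
    obtain ⟨i, j, hij, rfl⟩ := hl s (by simp)
    rw [List.prod_cons, Perm.sign_mul, ih fun s hs => hl s (List.mem_cons_of_mem _ hs),
      sign_swap (by rintro rfl; omega), List.length_cons, pow_succ']

theorem exists_list_adjacent {m : ℕ} (π : Perm (Fin m)) :
    ∃ l : List (Perm (Fin m)), (∀ s ∈ l, IsAdjacentTransposition s) ∧ l.prod = π := by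
  cases m with
  | zero => exact ⟨[], by simp, Subsingleton.elim _ _⟩
  | succ m =>
    obtain ⟨l, hl, h⟩ := Submonoid.exists_list_of_mem_closure
      (s := Set.range fun i : Fin m => swap i.castSucc i.succ) (x := π)
      (by rw [mclosure_swap_castSucc_succ]; trivial)
    refine ⟨l, fun s hs => ?_, h⟩
    obtain ⟨i, rfl⟩ := hl s hs
    exact ⟨i.castSucc, i.succ, by simp, rfl⟩

/-- Each adjacent transposition changes the sign, so equal signs exclude distance 1. -/
theorem two_le_kendallDist {m : ℕ} {π₁ π₂ : Perm (Fin m)} (hs : sign π₁ = sign π₂) (hne : π₁ ≠ π₂) :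
    2 ≤ kendallDist π₁ π₂ := by
  -- The infimum of the empty set would be 0.
  have hnonempty : {k : ℕ | ∃ l : List (Perm (Fin m)), l.length = k ∧
      (∀ s ∈ l, IsAdjacentTransposition s) ∧ π₂ = π₁ * l.prod}.Nonempty := by
    obtain ⟨l, hl, h⟩ := exists_list_adjacent (π₁⁻¹ * π₂)
    exact ⟨_, l, rfl, hl, by rw [h, mul_inv_cancel_left]⟩
  obtain ⟨l, hlen, hl, h⟩ := Nat.sInf_mem hnonempty
  change l.length = kendallDist π₁ π₂ at hlen
  rw [← hlen]
  by_contra! hlt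
  have hsign := sign_list_prod hl
  rw [h, Perm.sign_mul, left_eq_mul] at hs
  rw [hs] at hsign
  interval_cases hk : l.length
  · rw [List.length_eq_zero_iff.1 hk] at h
    exact hne (by simpa using h.symm)
  · exact absurd hsign (by decide)

end RankModulation

open RankModulation

theorem mainTheorem4
    (b : Set (P 3) → Set (P 3)) (hb : Set.BijOn b (chains 3) (necklaces21 3))
    (hconj : ∀ n : ℕ, 3 ≤ n → ∀ A : Comp n, IsComponent b n A → ∀ η ∈ A.2,
      ∃ F : Set (Sym2 (Comp n) × Set (P n) × ℕ),
        IsComponentsSpanningTree b n F ∧ ∀ e ∈ F, e.2.1 ≠ η)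
    (n : ℕ) (hn : 2 ≤ n) :
    ∃ c : Fin ((2 * n + 1).factorial / 2 - (2 * n - 1)) → Equiv.Perm (Fin (2 * n + 1)),
      IsKSnake c ∧ IsGrayCode {pushTop (2 * n - 1), pushTop (2 * n + 1)} c := by
  have hq : 2 * n - 1 - 1 < 2 * n + 1 := by omega
  have hl : 2 * n + 1 - 1 < 2 * n + 1 := by omega
  -- `q`, `y`, `z` are the last three positions, counted from 0.
  let q : Fin (2 * n + 1) := ⟨2 * n - 1 - 1, hq⟩
  let y : Fin (2 * n + 1) := ⟨2 * n - 1, by omega⟩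
  let z : Fin (2 * n + 1) := ⟨2 * n + 1 - 1, hl⟩
  have hyz : y ≠ z := by rw [Ne, Fin.ext_iff]; change 2 * n - 1 ≠ 2 * n + 1 - 1; omega
  have hqy : q ≠ y := by rw [Ne, Fin.ext_iff]; change 2 * n - 1 - 1 ≠ 2 * n - 1; omega
  have hqz : q ≠ z := by rw [Ne, Fin.ext_iff]; change 2 * n - 1 - 1 ≠ 2 * n + 1 - 1; omega
  have hq0 : q ≠ 0 := by rw [Ne, Fin.ext_iff]; change 2 * n - 1 - 1 ≠ 0; omega
  have hB : ∀ π : Equiv.Perm (Fin (2 * n + 1)), pushTop (2 * n - 1) π = π * (Fin.cycleRange q)⁻¹ :=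
    fun π => dif_pos hq
  have hA : ∀ π : Equiv.Perm (Fin (2 * n + 1)), pushTop (2 * n + 1) π = π * (Fin.cycleRange z)⁻¹ :=
    fun π => dif_pos hl
  have hqy' : q < y := by rw [Fin.lt_def]; change 2 * n - 1 - 1 < 2 * n - 1; omega
  have hqz' : q < z := by rw [Fin.lt_def]; change 2 * n - 1 - 1 < 2 * n + 1 - 1; omega
  have hyz' : y < z := by rw [Fin.lt_def]; change 2 * n - 1 < 2 * n + 1 - 1; omega
  have hsucc : ∀ p : Fin (2 * n + 1), p ≠ y → p ≠ z → p ≤ q := by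
    intro p hy hz
    rw [Ne, Fin.ext_iff] at hy hz
    have := p.2
    rw [Fin.le_def]
    change (p : ℕ) ≠ 2 * n - 1 at hy
    change (p : ℕ) ≠ 2 * n + 1 - 1 at hz
    change (p : ℕ) ≤ 2 * n - 1 - 1
    omega
  have hAB : (Fin.cycleRange z)⁻¹ * (Fin.cycleRange q)⁻¹⁻¹ = (rot3 q y z)⁻¹ := by
    rw [inv_inv, eq_inv_iff_mul_eq_one, mul_assoc, inv_mul_eq_one]
    ext x
    rw [Equiv.Perm.mul_apply]
    by_cases hxq : x = q
    · rw [hxq, rot3_p hqz hqy, Fin.cycleRange_of_gt hqy', Fin.coe_cycleRange_of_lt hqz']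
      change 2 * n - 1 - 1 + 1 = 2 * n - 1
      omega
    by_cases hxy : x = y
    · rw [hxy, rot3_a hyz hqz, Fin.cycleRange_of_gt hqz', Fin.coe_cycleRange_of_lt hyz']
      change 2 * n - 1 + 1 = 2 * n + 1 - 1
      omega
    by_cases hxz : x = z
    · rw [hxz, rot3_b, Fin.cycleRange_self, Fin.cycleRange_self]
    · have hx : x < q := lt_of_le_of_ne (hsucc x hxy hxz) hxq
      rw [rot3_of_ne hxq hxy hxz, Fin.coe_cycleRange_of_lt hx,
        Fin.coe_cycleRange_of_lt (hx.trans hqz')]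
  have hcycle := Fin.isCycle_cycleRange hq0
  have hmove : ∀ p, p ≤ q → Fin.cycleRange q p ≠ p := by
    intro p hp h
    have h := congrArg Fin.val h
    rw [Fin.coe_cycleRange_of_le hp] at h
    split_ifs at h with hpq
    · exact hq0 (by rw [← hpq]; exact Fin.ext h.symm)
    · omega
  have hord : orderOf (Fin.cycleRange q)⁻¹ = 2 * n - 1 := by
    rw [orderOf_inv, ← Equiv.Perm.lcm_cycleType, Fin.cycleType_cycleRange hq0]
    simp only [Multiset.lcm_singleton, normalize_eq]
    change 2 * n - 1 - 1 + 1 = 2 * n - 1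
    omega
  obtain ⟨t, hnd, hlen, hsign, ht⟩ := exists_cyclic_list_even (A := (Fin.cycleRange z)⁻¹)
    (B := (Fin.cycleRange q)⁻¹) (by rw [Fintype.card_fin]; omega) hyz hqy hqz
    (by rw [Equiv.Perm.inv_eq_iff_eq, Fin.cycleRange_of_gt hqy'])
    (by rw [Equiv.Perm.inv_eq_iff_eq, Fin.cycleRange_of_gt hqz'])
    (by
      rw [Equiv.Perm.sign_inv, Fin.sign_cycleRange]
      -- A cycle of odd length `2 * n - 1` is even.
      exact Even.neg_one_pow ⟨n - 1, by change 2 * n - 1 - 1 = _; omega⟩)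
    (fun p hpy hpz => by
      obtain ⟨i, hi⟩ := hcycle.exists_zpow_eq (hmove q le_rfl) (hmove p (hsucc p hpy hpz))
      exact ⟨-i, by rw [inv_zpow', neg_neg, hi]⟩) hAB
  rw [Fintype.card_fin, hord] at hlen
  have hgray : IsGrayCode {pushTop (2 * n - 1), pushTop (2 * n + 1)} t.get :=
    ht.isGrayCode (by
      rintro x y (rfl | rfl)
      · exact ⟨_, Or.inl rfl, (hB x).symm⟩
      · exact ⟨_, Or.inr rfl, (hA x).symm⟩) hnd
  rw [← hlen]
  refine ⟨t.get, ⟨⟨hgray.distinct, fun j => ?_⟩, fun i j hij => ?_⟩, hgray⟩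
  · obtain ⟨_, rfl | rfl, h⟩ := hgray.step j
    · exact ⟨_, ⟨2 * n - 1, by omega, by omega, rfl⟩, h⟩
    · exact ⟨_, ⟨2 * n + 1, by omega, by omega, rfl⟩, h⟩
  · exact two_le_kendallDist ((hsign _ (t.get_mem i)).trans (hsign _ (t.get_mem j)).symm)
      (hgray.distinct.ne hij)
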